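/- Let $\mathbb{U}^*=\{\zeta\in\mathbb{C}:|\zeta|>1\}$, and let $f$ be a meromorphic function in $\mathbb{U}^*$ which for all sufficiently large $|\zeta|$ has a convergent expansion $$f(\zeta)=b\,\zeta+b_0+\frac{b_1}{\zeta}+\frac{b_2}{\zeta^2}+\cdots\qquad(b,b_0,b_1,\ldots\in\mathbb{C}).$$ Suppose that $f$ is locally univalent in $\mathbb{U}^*$, that is, every point of $\mathbb{U}^*$ has a neighbourhood on which $f$ is injective as a map to the Riemann sphere $\mathbb{C}\cup\{\infty\}$ (so all poles of $f$ are simple). Let $$S_f=\left(\frac{f''}{f'}\right)'-\frac12\left(\frac{f''}{f'}\right)^2$$ be the Schwarzian derivative of $f$, extended by continuity to the poles of $f$. If $$|S_f(\zeta)|\le\frac{2}{(|\zeta|^2-1)^2}\qquad\text{for all }\zeta\in\mathbb{U}^*,$$ then $f$ is univalent in $\mathbb{U}^*$, that is, injective on $\mathbb{U}^*$ as a map to the Riemann sphere. -/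

import Mathlib

open Set Filter Topology

/-- The exterior `ℂ ∖ closure 𝕌` of the closed unit disk, as a subset of the finite plane. -/
def exteriorDisk : Set ℂ := {ζ : ℂ | 1 < ‖ζ‖}

open Classical in
/-- The value of a meromorphic function in the Riemann sphere `ℂ ∪ {∞}`: it is `∞` at a pole
and `f z` elsewhere. (The functions considered are in normal form: analytic away
from their poles, so that only the value at a pole has to be corrected.) -/
noncomputable def sphereValue (f : ℂ → ℂ) (z : ℂ) : OnePoint ℂ :=
  if meromorphicOrderAt f z < 0 then OnePoint.infty else (f z : OnePoint ℂ)

/-- Univalence (for meromorphic `f`): injectivity as a map to the Riemann sphere. -/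
def UnivalentOn (f : ℂ → ℂ) (s : Set ℂ) : Prop := InjOn (sphereValue f) s

/-- Local univalence: every point of `s` has a neighbourhood in `s` on which `f` is univalent. -/
def LocallyUnivalentOn (f : ℂ → ℂ) (s : Set ℂ) : Prop :=
  ∀ z ∈ s, ∃ V ∈ 𝓝[s] z, UnivalentOn f V

/-- The class `Σ`: functions `f` that are meromorphic in the exterior disk (represented by
their normal form: no removable singularities, and the value `0` as a placeholder at a pole) and
have, for all sufficiently large `|ζ|`, a convergent expansion
`f ζ = b ζ + b₀ + b₁ / ζ + b₂ / ζ² + ⋯`. -/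
structure MemSigma (f : ℂ → ℂ) : Prop where
  meromorphic : MeromorphicNFOn f exteriorDisk
  expansion : ∃ (b : ℂ) (c : ℕ → ℂ) (R : ℝ), ∀ ζ : ℂ, R < ‖ζ‖ → 1 < ‖ζ‖ →
    HasSum (fun n : ℕ => c n / ζ ^ n) (f ζ - b * ζ)

/-- The Schwarzian derivative `(f'' / f')' - (1/2) (f'' / f')²`, as a meromorphic function in
normal form. Where `f` is analytic with `f' ≠ 0` this is the literal value of the formula; at a
simple pole of `f`, where the formula has a removable singularity, it is the limit. -/
noncomputable def schwarzian (f : ℂ → ℂ) (z : ℂ) : ℂ :=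
  toMeromorphicNFAt
    (fun w => deriv (fun u => deriv (deriv f) u / deriv f u) w
      - (1 / 2) * (deriv (deriv f) w / deriv f w) ^ 2) z z

/-! Two distinct exterior points with the same value are joined by a hyperbolic geodesic. A Möbius
map `γ = toExterior a e` from the unit disk onto the exterior disk with `∞` carries `0` and some `r
∈ (0, 1)` to them (`exists_toExterior`). The Laurent expansion makes `g = f ∘ γ` meromorphic in the
whole disk, and the Schwarzian bound becomes Nehari's bound `2 / (1 - |z|²)²`.

If `c` is the common value, put `Q = (g - c)² / g'`; for a common pole put `Q = 1 / g'`. Formally `Q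
= u²` with `u'' + (S_g / 2) u = 0`, and `Q` vanishes at `0` and `r`. Working with `Q` avoids square
roots: the equation becomes `L' + L² / 2 = -S_g` for `L = Q' / Q`, and this rules out poles of `Q`.

Sturm comparison with the solution `√(1 - x²)` of `v'' + v / (1 - x²)² = 0`, which has no zeros in
`(-1, 1)`, forbids two such zeros (`no_consecutive_zeros`). Local univalence enters only to ensure
that `f'` vanishes identically near no point. -/

open scoped ComplexConjugate

/-! ### Sturm comparison on a real interval -/

/-- Derivative of `log ‖q‖` for a nonvanishing complex-valued function of a real variable. -/
lemma hasDerivAt_log_norm {q : ℝ → ℂ} {l : ℂ} {x : ℝ} (hq : HasDerivAt q (l * q x) x)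
    (h0 : q x ≠ 0) : HasDerivAt (fun t => Real.log ‖q t‖) l.re x := by
  have h1 := (hq.norm_sq).log (by positivity)
  have h2 : HasDerivAt (fun t => 1 / 2 * Real.log (‖q t‖ ^ 2))
      (1 / 2 * (2 * inner ℝ (q x) (l * q x) / ‖q x‖ ^ 2)) x := h1.const_mul _
  have h3 : inner ℝ (q x) (l * q x) = l.re * ‖q x‖ ^ 2 := by
    rw [Complex.inner, mul_assoc, Complex.mul_conj, ← Complex.normSq_eq_norm_sq]
    simp
  rw [h3] at h2
  have h4 : (‖q x‖ ^ 2) ≠ 0 := by positivity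
  convert h2 using 1
  · funext t
    rw [Real.log_pow]; push_cast; ring
  · field_simp

/-- Up to a positive factor this is the derivative of the Wronskian `(1 - x²) F'` in
`no_consecutive_zeros`. The lower bound on `Re (l' + l² / 2)` cancels the contribution of `√(1 -
x²)`, and what remains is a square. -/
lemma sturm_scalar_nonneg {a : ℝ} {l l' : ℂ} (ha : 0 < 1 - a ^ 2)
    (hb : ‖l' + 1 / 2 * l ^ 2‖ ≤ 2 / (1 - a ^ 2) ^ 2) :
    0 ≤ (1 - a ^ 2) * (l.re / 2 + a / (1 - a ^ 2)) ^ 2 - 2 * a * (l.re / 2 + a / (1 - a ^ 2))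
      + (1 - a ^ 2) * (l'.re / 2 + (1 + a ^ 2) / (1 - a ^ 2) ^ 2) := by
  have h1 := (abs_le.1 ((Complex.abs_re_le_norm _).trans hb)).1
  have h2 : (l' + 1 / 2 * l ^ 2).re = l'.re + (l.re ^ 2 - l.im ^ 2) / 2 := by
    simp [pow_two]
    ring
  rw [h2] at h1
  have h3 : (1 - a ^ 2) * (l.re / 2 + a / (1 - a ^ 2)) ^ 2 - 2 * a * (l.re / 2 + a / (1 - a ^ 2))
      + (1 - a ^ 2) * (l'.re / 2 + (1 + a ^ 2) / (1 - a ^ 2) ^ 2)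
      = (1 - a ^ 2) * (1 / 2 * (l'.re + (l.re ^ 2 - l.im ^ 2) / 2 + 2 / (1 - a ^ 2) ^ 2)
        + l.im ^ 2 / 4) := by
    field_simp
    ring
  rw [h3]
  -- Rotation of the complex solution only helps the inequality for its modulus.
  have : 0 ≤ l.im ^ 2 := sq_nonneg _
  apply mul_nonneg ha.le
  linarith

/-- Sturm comparison with the disconjugate equation `u'' + u / (1 - x²)² = 0`: a solution `q = u²`
of the Riccati-type inequality cannot vanish at both ends of an interval. -/
lemma no_consecutive_zeros {α β : ℝ} (hα : -1 < α) (hαβ : α < β) (hβ : β < 1)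
    {q l l' : ℝ → ℂ} (hc : ContinuousOn q (Icc α β)) (h0 : ∀ x ∈ Ioo α β, q x ≠ 0)
    (hq : ∀ x ∈ Ioo α β, HasDerivAt q (l x * q x) x)
    (hl : ∀ x ∈ Ioo α β, HasDerivAt l (l' x) x)
    (hb : ∀ x ∈ Ioo α β, ‖l' x + 1 / 2 * l x ^ 2‖ ≤ 2 / (1 - x ^ 2) ^ 2)
    (hqα : q α = 0) (hqβ : q β = 0) : False := by
  have hpos : ∀ x ∈ Icc α β, 0 < 1 - x ^ 2 := fun x hx => by nlinarith [hx.1, hx.2]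
  -- `F = |u| / v` with `|u|² = ‖q‖` and `v² = 1 - x²`; `G` below is `F' / F`.
  set F : ℝ → ℝ := fun x => √(‖q x‖ / (1 - x ^ 2)) with hF
  set G : ℝ → ℝ := fun x => (l x).re / 2 + x / (1 - x ^ 2) with hG
  have hFc : ContinuousOn F (Icc α β) :=
    ((hc.norm).div (by fun_prop) fun x hx => (hpos x hx).ne').sqrt
  have hFpos : ∀ x ∈ Ioo α β, 0 < F x := fun x hx =>
    Real.sqrt_pos.2 (div_pos (norm_pos_iff.2 (h0 x hx)) (hpos x (Ioo_subset_Icc_self hx)))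
  have hFd : ∀ x ∈ Ioo α β, HasDerivAt F (F x * G x) x := by
    intro x hx
    have hp := hpos x (Ioo_subset_Icc_self hx)
    have hE : ∀ t ∈ Ioo α β,
        F t = Real.exp (1 / 2 * (Real.log ‖q t‖ - Real.log (1 - t ^ 2))) := by
      intro t ht
      have h1 := norm_pos_iff.2 (h0 t ht)
      have h2 := hpos t (Ioo_subset_Icc_self ht)
      rw [← Real.log_div h1.ne' h2.ne', ← Real.exp_log (hFpos t ht), hF,
        Real.log_sqrt (div_pos h1 h2).le]
      congr 1; ring
    have h1 : HasDerivAt (fun t : ℝ => Real.log (1 - t ^ 2)) (-(2 * x) / (1 - x ^ 2)) x := by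
      have : HasDerivAt (fun t : ℝ => 1 - t ^ 2) (-(2 * x)) x := by
        simpa using (hasDerivAt_pow 2 x).const_sub 1
      exact this.log hp.ne'
    have h2 := (((hasDerivAt_log_norm (hq x hx) (h0 x hx)).sub h1).const_mul (1 / 2)).exp
    refine (h2.congr_of_eventuallyEq ?_).congr_deriv ?_
    · filter_upwards [Ioo_mem_nhds hx.1 hx.2] with t ht using hE t ht
    · rw [hE x hx]
      simp only [Pi.sub_apply]
      rw [hG]; ring
  have hGd : ∀ x ∈ Ioo α β,
      HasDerivAt G ((l' x).re / 2 + (1 + x ^ 2) / (1 - x ^ 2) ^ 2) x := by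
    intro x hx
    have hp := hpos x (Ioo_subset_Icc_self hx)
    have h1 : HasDerivAt (fun t => (l t).re) (l' x).re x := by
      have := (Complex.reCLM.hasFDerivAt (x := l x)).comp_hasDerivAt x (hl x hx)
      exact this
    have h2 : HasDerivAt (fun t : ℝ => 1 - t ^ 2) (-(2 * x)) x := by
      simpa using (hasDerivAt_pow 2 x).const_sub 1
    refine ((h1.div_const 2).add ((hasDerivAt_id x).div h2 hp.ne')).congr_deriv ?_
    simp only [id]
    congr 2; ring
  have hHd : ∀ x ∈ Ioo α β, ∃ d, 0 ≤ d ∧ HasDerivAt (fun t => (1 - t ^ 2) * F t * G t) d x := by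
    intro x hx
    have hp := hpos x (Ioo_subset_Icc_self hx)
    have h2 : HasDerivAt (fun t : ℝ => 1 - t ^ 2) (-(2 * x)) x := by
      simpa using (hasDerivAt_pow 2 x).const_sub 1
    refine ⟨_, ?_, (h2.mul (hFd x hx)).mul (hGd x hx)⟩
    have h3 := mul_nonneg (hFpos x hx).le (sturm_scalar_nonneg hp (hb x hx))
    refine h3.trans_eq ?_
    simp only [hG, Pi.mul_apply]; ring
  obtain ⟨c, hc, hmax⟩ := isCompact_Icc.exists_isMaxOn (nonempty_Icc.2 hαβ.le) hFc
  have hm : (α + β) / 2 ∈ Ioo α β := ⟨by linarith, by linarith⟩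
  have hFcpos : 0 < F c := (hFpos _ hm).trans_le (hmax (Ioo_subset_Icc_self hm))
  have hFα : F α = 0 := by simp [hF, hqα]
  have hFβ : F β = 0 := by simp [hF, hqβ]
  have hcI : c ∈ Ioo α β := by
    refine ⟨lt_of_le_of_ne hc.1 ?_, lt_of_le_of_ne hc.2 ?_⟩ <;> rintro rfl <;> linarith
  have hGc : G c = 0 := by
    have h1 : IsLocalMax F c := hmax.isLocalMax (Icc_mem_nhds hcI.1 hcI.2)
    have := h1.hasDerivAt_eq_zero (hFd c hcI)
    exact (mul_eq_zero.1 this).resolve_left hFcpos.ne'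
  have hHmono : MonotoneOn (fun t => (1 - t ^ 2) * F t * G t) (Ioo α β) := by
    refine monotoneOn_of_deriv_nonneg (convex_Ioo _ _) ?_ ?_ ?_
    · intro x hx
      obtain ⟨d, -, hd⟩ := hHd x hx
      exact hd.continuousAt.continuousWithinAt
    · rw [interior_Ioo]
      intro x hx
      obtain ⟨d, -, hd⟩ := hHd x hx
      exact hd.differentiableAt.differentiableWithinAt
    · rw [interior_Ioo]
      intro x hx
      obtain ⟨d, h, hd⟩ := hHd x hx
      rwa [hd.deriv]
  -- `(1 - x²) F'` is nondecreasing and vanishes at the interior maximum `c`, so `F` cannot fall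
  -- back to `0` at `β`.
  have hFmono : MonotoneOn F (Icc c β) := by
    refine monotoneOn_of_deriv_nonneg (convex_Icc _ _)
      (hFc.mono (Icc_subset_Icc_left hc.1)) ?_ ?_
    · rw [interior_Icc]
      intro x hx
      exact (hFd x ⟨hcI.1.trans hx.1, hx.2⟩).differentiableAt.differentiableWithinAt
    · rw [interior_Icc]
      intro x hx
      have hx' : x ∈ Ioo α β := ⟨hcI.1.trans hx.1, hx.2⟩
      have h1 := hHmono hcI hx' hx.1.le
      simp only [hGc, mul_zero] at h1
      rw [(hFd x hx').deriv]
      rw [mul_assoc] at h1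
      exact nonneg_of_mul_nonneg_right h1 (hpos x (Ioo_subset_Icc_self hx'))
  have := hFmono ⟨le_rfl, hc.2⟩ ⟨hc.2, le_rfl⟩ hc.2
  linarith

/-- Between two zeros of a continuous function lies an interval between consecutive zeros. -/
lemma exists_consecutive_zeros {a b t : ℝ} {q : ℝ → ℂ} (hc : ContinuousOn q (Icc a b))
    (ht : t ∈ Icc a b) (hqt : q t ≠ 0) (ha : q a = 0) (hb : q b = 0) :
    ∃ α β, a ≤ α ∧ α < β ∧ β ≤ b ∧ q α = 0 ∧ q β = 0 ∧ ∀ x ∈ Ioo α β, q x ≠ 0 := by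
  have hK : ∀ c d, Icc c d ⊆ Icc a b → IsCompact (Icc c d ∩ q ⁻¹' {0}) := by
    intro c d h
    exact isCompact_Icc.of_isClosed_subset
      ((hc.mono h).preimage_isClosed_of_isClosed isClosed_Icc isClosed_singleton)
      inter_subset_left
  obtain ⟨α, hα⟩ := (hK a t (Icc_subset_Icc_right ht.2)).exists_isGreatest
    ⟨a, ⟨le_rfl, ht.1⟩, ha⟩
  obtain ⟨β, hβ⟩ := (hK t b (Icc_subset_Icc_left ht.1)).exists_isLeast
    ⟨b, ⟨ht.2, le_rfl⟩, hb⟩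
  have hαt : α < t := lt_of_le_of_ne hα.1.1.2 fun h => hqt (h ▸ hα.1.2)
  have htβ : t < β := lt_of_le_of_ne hβ.1.1.1 fun h => hqt (h ▸ hβ.1.2)
  refine ⟨α, β, hα.1.1.1, hαt.trans htβ, hβ.1.1.2, hα.1.2, hβ.1.2, fun x hx h => ?_⟩
  rcases le_total x t with hxt | hxt
  · exact absurd (hα.2 ⟨⟨hα.1.1.1.trans hx.1.le, hxt⟩, h⟩) (not_le.2 hx.1)
  · exact absurd (hβ.2 ⟨⟨hxt, hx.2.le.trans hβ.1.1.2⟩, h⟩) (not_le.2 hx.2)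

/-! ### The Riccati expression and zeros of `Q` in the disk -/

/-- The expression `L' + L² / 2` with `L = Q' / Q`. For `Q = 1 / g'` it is `-S_g`. -/
noncomputable def riccati (Q : ℂ → ℂ) (z : ℂ) : ℂ :=
  deriv (logDeriv Q) z + 1 / 2 * logDeriv Q z ^ 2

lemma riccati_congr_nhdsNE {P Q : ℂ → ℂ} {z : ℂ} (h : P =ᶠ[𝓝[≠] z] Q) :
    riccati P =ᶠ[𝓝[≠] z] riccati Q := by
  have h1 := logDeriv_congr_nhdsNE h
  filter_upwards [h1, h1.nhdsNE_deriv] with w hw hw'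
  simp only [riccati, hw, hw']

lemma analyticAt_logDeriv {Q : ℂ → ℂ} {z : ℂ} (hQ : AnalyticAt ℂ Q z) (h0 : Q z ≠ 0) :
    AnalyticAt ℂ (logDeriv Q) z :=
  hQ.deriv.div hQ h0

lemma continuousAt_riccati {Q : ℂ → ℂ} {z : ℂ} (hQ : AnalyticAt ℂ Q z) (h0 : Q z ≠ 0) :
    ContinuousAt (riccati Q) z := by
  have h := analyticAt_logDeriv hQ h0
  exact (h.deriv.add (analyticAt_const.mul (h.pow 2))).continuousAt

/-- Boundedness of `L' + L² / 2` forces the order of `Q` to be `0` or `2`. -/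
lemma meromorphicOrderAt_nonneg_of_riccati_bounded {Q : ℂ → ℂ} {z : ℂ} (hQ : MeromorphicAt Q z)
    {C : ℝ} (hC : ∀ᶠ w in 𝓝[≠] z, Q w ≠ 0 ∧ ‖riccati Q w‖ ≤ C) :
    0 ≤ meromorphicOrderAt Q z := by
  have hne := (meromorphicOrderAt_ne_top_iff_eventually_ne_zero hQ).2 (hC.mono fun w h => h.1)
  lift meromorphicOrderAt Q z to ℤ using hne with n hn
  obtain ⟨e, hea, he0, heq⟩ := (meromorphicOrderAt_eq_int_iff hQ).1 hn.symm
  have hM := analyticAt_logDeriv hea he0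
  set M := logDeriv e
  have hL : logDeriv Q =ᶠ[𝓝[≠] z] fun w => n / (w - z) + M w := by
    refine (logDeriv_congr_nhdsNE heq).trans ?_
    filter_upwards [hea.eventually_analyticAt.filter_mono nhdsWithin_le_nhds,
      (hea.continuousAt.eventually_ne he0).filter_mono nhdsWithin_le_nhds,
      self_mem_nhdsWithin] with w hw hw0 hwz
    have hwz' : w - z ≠ 0 := sub_ne_zero.2 hwz
    simp only [smul_eq_mul]
    rw [logDeriv_mul (f := fun u => (u - z) ^ n) w (zpow_ne_zero _ hwz') hw0
      (by fun_prop (disch := grind)) hw.differentiableAt, logDeriv_fun_zpow (by fun_prop)]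
    congr 1
    simp [logDeriv_apply, div_eq_mul_inv]
  -- A factor `(w - z)^n` contributes `n / (w - z)` to `L`. After multiplication by `(w - z)²` the
  -- limit at `z` gives `0 = -n + n² / 2`.
  have hR : ∀ᶠ w in 𝓝[≠] z, (w - z) ^ 2 * riccati Q w =
      -n + (w - z) ^ 2 * deriv M w + 1 / 2 * (n + (w - z) * M w) ^ 2 := by
    filter_upwards [hL, hL.nhdsNE_deriv, self_mem_nhdsWithin,
      hM.eventually_analyticAt.filter_mono nhdsWithin_le_nhds] with w h1 h2 hwz hMw
    have hwz' : w - z ≠ 0 := sub_ne_zero.2 hwz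
    have hd : HasDerivAt (fun w => n / (w - z) + M w)
        (-n / (w - z) ^ 2 + deriv M w) w := by
      refine (((hasDerivAt_const w (n : ℂ)).div ((hasDerivAt_id w).sub_const z) hwz').add
        hMw.differentiableAt.hasDerivAt).congr_deriv ?_
      simp
    rw [riccati, h1, h2, hd.deriv]
    field_simp
  have hzero : Tendsto (fun w : ℂ => w - z) (𝓝[≠] z) (𝓝 0) :=
    ((continuous_id.sub continuous_const).tendsto' z 0 (sub_self z)).mono_left nhdsWithin_le_nhds
  have ht1 : Tendsto (fun w => (w - z) ^ 2 * riccati Q w) (𝓝[≠] z) (𝓝 0) := by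
    have h0 : Tendsto (fun w : ℂ => ‖(w - z) ^ 2‖ * C) (𝓝[≠] z) (𝓝 0) := by
      simpa using ((hzero.pow 2).norm).mul_const C
    refine squeeze_zero_norm' ?_ h0
    filter_upwards [hC] with w hw
    rw [norm_mul]
    exact mul_le_mul_of_nonneg_left hw.2 (norm_nonneg _)
  have ht2 : Tendsto (fun w => -n + (w - z) ^ 2 * deriv M w + 1 / 2 * (n + (w - z) * M w) ^ 2)
      (𝓝[≠] z) (𝓝 (-n + 0 ^ 2 * deriv M z + 1 / 2 * (n + 0 * M z) ^ 2)) := by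
    have h1 : Tendsto M (𝓝[≠] z) (𝓝 (M z)) := hM.continuousAt.tendsto.mono_left nhdsWithin_le_nhds
    have h2 : Tendsto (deriv M) (𝓝[≠] z) (𝓝 (deriv M z)) :=
      hM.deriv.continuousAt.tendsto.mono_left nhdsWithin_le_nhds
    exact (tendsto_const_nhds.add ((hzero.pow 2).mul h2)).add
      (tendsto_const_nhds.mul ((tendsto_const_nhds.add (hzero.mul h1)).pow 2))
  have heqn := tendsto_nhds_unique (ht1.congr' hR) ht2
  have h3 : (n : ℂ) ^ 2 = 2 * n := by linear_combination -2 * heqn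
  have h4 : n ^ 2 = 2 * n := by exact_mod_cast h3
  exact_mod_cast (by nlinarith : 0 ≤ n)

lemma not_two_zeros_of_analyticOnNhd {P : ℂ → ℂ} {r : ℝ} (hr0 : 0 < r) (hr1 : r < 1)
    (hP : AnalyticOnNhd ℂ P (Metric.ball 0 1)) (hne : ∀ᶠ w in 𝓝[≠] (0 : ℂ), P w ≠ 0)
    (hb : ∀ z ∈ Metric.ball (0 : ℂ) 1, P z ≠ 0 → ‖riccati P z‖ ≤ 2 / (1 - ‖z‖ ^ 2) ^ 2)
    (h0 : P 0 = 0) (hr : P r = 0) : False := by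
  have hball : ∀ x ∈ Icc 0 r, (x : ℂ) ∈ Metric.ball (0 : ℂ) 1 := by
    intro x hx
    simp [abs_of_nonneg hx.1, hx.2.trans_lt hr1]
  have hcont : ContinuousOn (fun x : ℝ => P x) (Icc 0 r) := fun x hx =>
    ((hP x (hball x hx)).continuousAt.comp
      Complex.continuous_ofReal.continuousAt).continuousWithinAt
  have htend : Tendsto (fun x : ℝ => (x : ℂ)) (𝓝[>] 0) (𝓝[≠] 0) := by
    refine tendsto_nhdsWithin_of_tendsto_nhds_of_eventually_within _
      ((Complex.continuous_ofReal.tendsto' 0 0 (by simp)).mono_left nhdsWithin_le_nhds) ?_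
    filter_upwards [self_mem_nhdsWithin] with x hx
    simpa using (ne_of_gt hx)
  -- A point where `P ≠ 0` is needed to separate two consecutive zeros on the segment.
  obtain ⟨t, htne, ht⟩ := ((htend.eventually hne).and (Ioo_mem_nhdsGT hr0)).exists
  obtain ⟨α, β, hα, hαβ, hβ, hqα, hqβ, hq⟩ := exists_consecutive_zeros hcont
    (Ioo_subset_Icc_self ht) htne (by simpa using h0) hr
  have hsub : ∀ x ∈ Icc α β, x ∈ Icc 0 r := fun x hx => ⟨hα.trans hx.1, hx.2.trans hβ⟩
  have hA : ∀ x ∈ Ioo α β, AnalyticAt ℂ P x :=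
    fun x hx => hP x (hball x (hsub x (Ioo_subset_Icc_self hx)))
  refine no_consecutive_zeros (q := fun x : ℝ => P x) (l := fun x : ℝ => logDeriv P x)
    (l' := fun x : ℝ => deriv (logDeriv P) x) (by linarith) hαβ (hβ.trans_lt hr1)
    (hcont.mono hsub) hq ?_ ?_ ?_ hqα hqβ
  · intro x hx
    refine (hA x hx).differentiableAt.hasDerivAt.comp_ofReal.congr_deriv ?_
    rw [logDeriv_apply, div_mul_cancel₀ _ (hq x hx)]
  · intro x hx
    exact (analyticAt_logDeriv (hA x hx) (hq x hx)).differentiableAt.hasDerivAt.comp_ofReal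
  · intro x hx
    have := hb x (hball x (hsub x (Ioo_subset_Icc_self hx))) (hq x hx)
    simpa [riccati] using this

lemma continuousAt_nehari_bound {z : ℂ} (hz : z ∈ Metric.ball (0 : ℂ) 1) :
    ContinuousAt (fun w : ℂ => 2 / (1 - ‖w‖ ^ 2) ^ 2) z := by
  have : ‖z‖ < 1 := by simpa using hz
  have h1 : 1 - ‖z‖ ^ 2 ≠ 0 := by nlinarith [norm_nonneg z]
  exact continuousAt_const.div (by fun_prop) (pow_ne_zero _ h1)

/-- The Riccati bound excludes poles, so the normal form of `Q` is analytic. The bound then passes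
to every nonzero point by continuity, and the analytic case applies. -/
lemma not_two_zeros_of_meromorphicOn {Q : ℂ → ℂ} {r : ℝ} (hr0 : 0 < r) (hr1 : r < 1)
    (hQ : MeromorphicOn Q (Metric.ball 0 1))
    (hb : ∀ z ∈ Metric.ball (0 : ℂ) 1,
      ∀ᶠ w in 𝓝[≠] z, Q w ≠ 0 ∧ ‖riccati Q w‖ ≤ 2 / (1 - ‖w‖ ^ 2) ^ 2)
    (h0 : 0 < meromorphicOrderAt Q 0) (hr : 0 < meromorphicOrderAt Q r) : False := by
  have hmem0 : (0 : ℂ) ∈ Metric.ball (0 : ℂ) 1 := by simp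
  have hmemr : (r : ℂ) ∈ Metric.ball (0 : ℂ) 1 := by simp [abs_of_pos hr0, hr1]
  set P := toMeromorphicNFOn Q (Metric.ball 0 1)
  have hNF : MeromorphicNFOn P (Metric.ball 0 1) := meromorphicNFOn_toMeromorphicNFOn _ _
  have hPQ : ∀ z ∈ Metric.ball (0 : ℂ) 1, P =ᶠ[𝓝[≠] z] Q :=
    fun z hz => hQ.toMeromorphicNFOn_eq_self_on_nhdsNE hz
  have hPA : AnalyticOnNhd ℂ P (Metric.ball 0 1) := by
    intro z hz
    rw [← (hNF hz).meromorphicOrderAt_nonneg_iff_analyticAt, meromorphicOrderAt_congr (hPQ z hz)]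
    refine meromorphicOrderAt_nonneg_of_riccati_bounded (hQ z hz)
      (C := 2 / (1 - ‖z‖ ^ 2) ^ 2 + 1) ?_
    filter_upwards [hb z hz, ((continuousAt_nehari_bound hz).eventually_lt_const
      (lt_add_one _)).filter_mono nhdsWithin_le_nhds] with w hw hw'
    exact ⟨hw.1, hw.2.trans hw'.le⟩
  have hzero : ∀ z ∈ Metric.ball (0 : ℂ) 1, 0 < meromorphicOrderAt Q z → P z = 0 := by
    intro z hz h
    by_contra hne
    rw [← ne_eq, ← (hNF hz).meromorphicOrderAt_eq_zero_iff, meromorphicOrderAt_congr (hPQ z hz)] at hne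
    exact h.ne' hne
  refine not_two_zeros_of_analyticOnNhd hr0 hr1 hPA ?_ ?_ (hzero 0 hmem0 h0) (hzero r hmemr hr)
  · filter_upwards [hb 0 hmem0, hPQ 0 hmem0] with w hw hw'
    rw [hw']
    exact hw.1
  · intro z hz hz0
    have h1 := (continuousAt_riccati (hPA z hz) hz0).norm.tendsto.mono_left
      (nhdsWithin_le_nhds (s := {z}ᶜ))
    have h2 := (continuousAt_nehari_bound hz).tendsto.mono_left (nhdsWithin_le_nhds (s := {z}ᶜ))
    refine le_of_tendsto_of_tendsto h1 h2 ?_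
    filter_upwards [hb z hz, riccati_congr_nhdsNE (hPQ z hz)] with w hw hw'
    rw [hw']
    exact hw.2

/-! ### Nehari's criterion in the unit disk -/

/-- The literal Schwarzian formula, without normalization at removable singularities. -/
noncomputable def schwarzianFormula (f : ℂ → ℂ) (z : ℂ) : ℂ :=
  deriv (logDeriv (deriv f)) z - 1 / 2 * logDeriv (deriv f) z ^ 2

lemma analyticAt_schwarzianFormula {f : ℂ → ℂ} {z : ℂ} (hf : AnalyticAt ℂ f z)
    (h0 : deriv f z ≠ 0) : AnalyticAt ℂ (schwarzianFormula f) z := by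
  have h := analyticAt_logDeriv hf.deriv h0
  exact h.deriv.sub (analyticAt_const.mul (h.pow 2))

lemma riccati_inv_deriv {g : ℂ → ℂ} {z : ℂ} (hg : AnalyticAt ℂ g z) (h0 : deriv g z ≠ 0) :
    riccati (deriv g)⁻¹ z = -schwarzianFormula g z := by
  have h1 : logDeriv (deriv g)⁻¹ =ᶠ[𝓝 z] -logDeriv (deriv g) := by
    filter_upwards [hg.eventually_analyticAt, hg.deriv.continuousAt.eventually_ne h0] with w hw hw0
    have := (hw.deriv.differentiableAt.hasDerivAt.inv hw0).deriv
    simp only [logDeriv_apply, Pi.neg_apply, Pi.inv_apply, this]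
    field_simp
  rw [riccati, h1.deriv_eq, h1.eq_of_nhds, schwarzianFormula, deriv.neg, Pi.neg_apply]
  ring

/-- With `h = 1 / (g - c)` one has `1 / h' = -(g - c)² / g'`, and `S_h = S_g` by Möbius invariance;
the sign does not affect `logDeriv`. The proof is the direct computation. -/
lemma riccati_sq_div_deriv {g : ℂ → ℂ} {z c : ℂ} (hg : AnalyticAt ℂ g z) (h0 : deriv g z ≠ 0)
    (hc : g z ≠ c) :
    riccati ((fun w => g w - c) ^ 2 / deriv g) z = -schwarzianFormula g z := by
  have h1 : logDeriv ((fun w => g w - c) ^ 2 / deriv g) =ᶠ[𝓝 z]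
      fun w => 2 * deriv g w / (g w - c) - logDeriv (deriv g) w := by
    filter_upwards [hg.eventually_analyticAt, hg.deriv.continuousAt.eventually_ne h0,
      hg.continuousAt.eventually_ne hc] with w hw hw0 hwc
    have hs : g w - c ≠ 0 := sub_ne_zero.2 hwc
    have hd := hw.differentiableAt.hasDerivAt
    have := (((hd.sub_const c).pow 2).div hw.deriv.differentiableAt.hasDerivAt hw0).deriv
    simp only [logDeriv_apply, Pi.div_apply, Pi.pow_apply, this]
    field_simp
    push_cast
    ring
  have hs : g z - c ≠ 0 := sub_ne_zero.2 hc
  have hM := (analyticAt_logDeriv hg.deriv h0).differentiableAt.hasDerivAt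
  have hd : HasDerivAt (fun w => 2 * deriv g w / (g w - c) - logDeriv (deriv g) w)
      ((2 * deriv (deriv g) z * (g z - c) - 2 * deriv g z * deriv g z) / (g z - c) ^ 2
        - deriv (logDeriv (deriv g)) z) z :=
    ((hg.deriv.differentiableAt.hasDerivAt.const_mul 2).div
      (hg.differentiableAt.hasDerivAt.sub_const c) hs).sub hM
  have hg2 : deriv (deriv g) z = logDeriv (deriv g) z * deriv g z := by
    rw [logDeriv_apply, div_mul_cancel₀ _ h0]
  rw [riccati, h1.deriv_eq, h1.eq_of_nhds, schwarzianFormula, hd.deriv, hg2]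
  field_simp
  ring

/-- Nehari's criterion in the unit disk, for the points `0` and `r` and in terms of orders. -/
lemma nehari_zero_real {g : ℂ → ℂ} {r : ℝ} (hr0 : 0 < r) (hr1 : r < 1)
    (hg : MeromorphicOn g (Metric.ball 0 1))
    (hb : ∀ z ∈ Metric.ball (0 : ℂ) 1,
      ∀ᶠ w in 𝓝[≠] z, deriv g w ≠ 0 ∧ ‖schwarzianFormula g w‖ ≤ 2 / (1 - ‖w‖ ^ 2) ^ 2)
    (h : (meromorphicOrderAt g 0 < 0 ∧ meromorphicOrderAt g r < 0) ∨
      ∃ c, 0 < meromorphicOrderAt (fun w => g w - c) 0 ∧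
        0 < meromorphicOrderAt (fun w => g w - c) r) : False := by
  have hmem0 : (0 : ℂ) ∈ Metric.ball (0 : ℂ) 1 := by simp
  have hmemr : (r : ℂ) ∈ Metric.ball (0 : ℂ) 1 := by simp [abs_of_pos hr0, hr1]
  have hd0 : ∀ z ∈ Metric.ball (0 : ℂ) 1, ∀ᶠ w in 𝓝[≠] z, deriv g w ≠ 0 :=
    fun z hz => (hb z hz).mono fun w hw => hw.1
  have hsub : ∀ c, MeromorphicOn (fun w => g w - c) (Metric.ball 0 1) :=
    fun c z hz => (hg z hz).sub (MeromorphicAt.const c z)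
  rcases h with ⟨h0, hr⟩ | ⟨c, h0, hr⟩
  · have key : ∀ z ∈ Metric.ball (0 : ℂ) 1, meromorphicOrderAt g z < 0 →
        0 < meromorphicOrderAt (deriv g)⁻¹ z := by
      intro z hz hneg
      lift meromorphicOrderAt g z to ℤ using (ne_top_of_lt hneg) with n hn
      have hn0 : n < 0 := by exact_mod_cast hneg
      rw [meromorphicOrderAt_inv, meromorphicOrderAt_deriv_eq_sub_one
        (by exact_mod_cast hn0.ne) hn.symm]
      have : (0 : ℤ) < -(n - 1) := by omega
      exact_mod_cast this
    refine not_two_zeros_of_meromorphicOn hr0 hr1 (fun z hz => (hg z hz).deriv.inv) ?_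
      (key 0 hmem0 h0) (key r hmemr hr)
    intro z hz
    filter_upwards [hb z hz, (hg z hz).eventually_analyticAt] with w hw hw'
    refine ⟨inv_ne_zero hw.1, ?_⟩
    rw [riccati_inv_deriv hw' hw.1, norm_neg]
    exact hw.2
  · have hne : ∀ z ∈ Metric.ball (0 : ℂ) 1, ∀ᶠ w in 𝓝[≠] z, g w - c ≠ 0 := by
      intro z hz
      refine (hsub c z hz).eventually_eq_zero_or_eventually_ne_zero.resolve_left fun hev => ?_
      have h1 : deriv (fun w => g w - c) =ᶠ[𝓝[≠] z] deriv (fun _ => (0 : ℂ)) :=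
        EventuallyEq.nhdsNE_deriv hev
      obtain ⟨w, hw, hw'⟩ := (h1.and (hd0 z hz)).exists
      simp only [deriv_sub_const, deriv_const] at hw
      exact hw' hw
    have key : ∀ z ∈ Metric.ball (0 : ℂ) 1, 0 < meromorphicOrderAt (fun w => g w - c) z →
        0 < meromorphicOrderAt ((fun w => g w - c) ^ 2 / deriv g) z := by
      intro z hz hpos
      have htop := (meromorphicOrderAt_ne_top_iff_eventually_ne_zero (hsub c z hz)).2 (hne z hz)
      have hdg : deriv g = deriv (fun w => g w - c) := by funext w; simp
      rw [meromorphicOrderAt_div ((hsub c z hz).pow 2) (hg z hz).deriv,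
        meromorphicOrderAt_pow (hsub c z hz), hdg]
      lift meromorphicOrderAt (fun w => g w - c) z to ℤ using htop with n hn
      have hn0 : 0 < n := by exact_mod_cast hpos
      rw [meromorphicOrderAt_deriv_eq_sub_one (by exact_mod_cast hn0.ne') hn.symm]
      -- An `n`-fold zero of `g - c` gives `Q` order `2n - (n - 1) = n + 1`.
      have he : ((2 : ℕ) : WithTop ℤ) * n - ((n - 1 : ℤ) : WithTop ℤ)
          = ((2 * n - (n - 1) : ℤ) : WithTop ℤ) := rfl
      rw [he]
      exact_mod_cast (by omega : (0 : ℤ) < 2 * n - (n - 1))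
    refine not_two_zeros_of_meromorphicOn hr0 hr1
      (fun z hz => ((hsub c z hz).pow 2).div (hg z hz).deriv) ?_ (key 0 hmem0 h0) (key r hmemr hr)
    intro z hz
    filter_upwards [hb z hz, (hg z hz).eventually_analyticAt, hne z hz] with w hw hw' hwc
    refine ⟨div_ne_zero (pow_ne_zero _ hwc) hw.1, ?_⟩
    rw [riccati_sq_div_deriv hw' hw.1 (sub_ne_zero.1 hwc), norm_neg]
    exact hw.2

/-! ### Möbius maps from the disk to the exterior -/

lemma norm_sq_one_add_conj_mul_sub (a x : ℂ) :
    ‖1 + conj a * x‖ ^ 2 - ‖x + a‖ ^ 2 = (1 - ‖x‖ ^ 2) * (1 - ‖a‖ ^ 2) := by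
  simp only [← Complex.normSq_eq_norm_sq, Complex.normSq_apply, Complex.add_re, Complex.add_im,
    Complex.mul_re, Complex.mul_im, Complex.conj_re, Complex.conj_im, Complex.one_re,
    Complex.one_im]
  ring

/-- For `‖e‖ = 1`, `‖a‖ < 1` the Möbius map from the unit disk onto the exterior disk (with `∞`)
which sends `0` to `1 / a`. -/
noncomputable def toExterior (a e T : ℂ) : ℂ := (1 + conj a * (e * T)) / (e * T + a)

section
variable {a e T : ℂ}

lemma norm_toExterior_sq_sub_one (he : ‖e‖ = 1) (hT : e * T + a ≠ 0) :
    ‖toExterior a e T‖ ^ 2 - 1 = (1 - ‖T‖ ^ 2) * (1 - ‖a‖ ^ 2) / ‖e * T + a‖ ^ 2 := by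
  have h := norm_sq_one_add_conj_mul_sub a (e * T)
  rw [norm_mul e T, he, one_mul] at h
  have h0 : ‖e * T + a‖ ≠ 0 := norm_ne_zero_iff.2 hT
  rw [toExterior, norm_div, ← h]
  field_simp

lemma toExterior_mem (he : ‖e‖ = 1) (ha : ‖a‖ < 1) (hT1 : ‖T‖ < 1) (hT : e * T + a ≠ 0) :
    toExterior a e T ∈ exteriorDisk := by
  have h := norm_toExterior_sq_sub_one he hT
  have h1 : 0 < 1 - ‖T‖ ^ 2 := by nlinarith [norm_nonneg T]
  have h2 : 0 < 1 - ‖a‖ ^ 2 := by nlinarith [norm_nonneg a]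
  have h3 : 0 < ‖e * T + a‖ := norm_pos_iff.2 hT
  have h4 : 0 < ‖toExterior a e T‖ ^ 2 - 1 := by rw [h]; positivity
  change 1 < ‖toExterior a e T‖
  nlinarith [norm_nonneg (toExterior a e T)]

lemma analyticAt_toExterior (hT : e * T + a ≠ 0) : AnalyticAt ℂ (toExterior a e) T := by
  unfold toExterior
  fun_prop (disch := exact hT)

lemma hasDerivAt_toExterior (hT : e * T + a ≠ 0) :
    HasDerivAt (toExterior a e) (e * (‖a‖ ^ 2 - 1) / (e * T + a) ^ 2) T := by
  have h1 : HasDerivAt (fun T => e * T) e T := by simpa using (hasDerivAt_id T).const_mul e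
  refine (((h1.const_mul (conj a)).const_add 1).div (h1.add_const a) hT).congr_deriv ?_
  have h2 : conj a * a = (‖a‖ : ℂ) ^ 2 := by
    rw [mul_comm, Complex.mul_conj, Complex.normSq_eq_norm_sq]; push_cast; ring
  rw [← h2]
  congr 1; ring

lemma toExterior_deriv_ne_zero (he : ‖e‖ = 1) (ha : ‖a‖ < 1) (hT : e * T + a ≠ 0) :
    e * ((‖a‖ : ℂ) ^ 2 - 1) / (e * T + a) ^ 2 ≠ 0 := by
  have h1 : e ≠ 0 := norm_ne_zero_iff.1 (by rw [he]; exact one_ne_zero)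
  have h2 : ‖a‖ ^ 2 - 1 ≠ 0 := by nlinarith [norm_nonneg a]
  have h3 : (‖a‖ : ℂ) ^ 2 - 1 ≠ 0 := by exact_mod_cast h2
  exact div_ne_zero (mul_ne_zero h1 h3) (pow_ne_zero _ hT)

lemma norm_toExterior_deriv (he : ‖e‖ = 1) (ha : ‖a‖ < 1) :
    ‖e * ((‖a‖ : ℂ) ^ 2 - 1) / (e * T + a) ^ 2‖ = (1 - ‖a‖ ^ 2) / ‖e * T + a‖ ^ 2 := by
  have h2 : ‖a‖ ^ 2 - 1 ≤ 0 := by nlinarith [norm_nonneg a]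
  have h3 : (‖a‖ : ℂ) ^ 2 - 1 = ((‖a‖ ^ 2 - 1 : ℝ) : ℂ) := by push_cast; rfl
  rw [norm_div, norm_mul, he, one_mul, h3, Complex.norm_real, Real.norm_of_nonpos h2, norm_pow]
  congr 1; ring

lemma deriv_comp_toExterior {f : ℂ → ℂ} (hf : AnalyticAt ℂ f (toExterior a e T))
    (hT : e * T + a ≠ 0) : deriv (f ∘ toExterior a e) T =
      deriv f (toExterior a e T) * (e * (‖a‖ ^ 2 - 1) / (e * T + a) ^ 2) :=
  (hf.differentiableAt.hasDerivAt.comp T (hasDerivAt_toExterior hT)).deriv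

/-- Transformation of the Schwarzian under composition with a Möbius map. -/
lemma schwarzianFormula_comp_toExterior (he : ‖e‖ = 1) (ha : ‖a‖ < 1) {f : ℂ → ℂ}
    (hf : AnalyticAt ℂ f (toExterior a e T)) (h0 : deriv f (toExterior a e T) ≠ 0)
    (hT : e * T + a ≠ 0) : schwarzianFormula (f ∘ toExterior a e) T =
      schwarzianFormula f (toExterior a e T) * (e * (‖a‖ ^ 2 - 1) / (e * T + a) ^ 2) ^ 2 := by
  have hγ := analyticAt_toExterior hT
  have hlin : ∀ u, HasDerivAt (fun T => e * T + a) e u := fun u => by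
    simpa using ((hasDerivAt_id u).const_mul e).add_const a
  have hev : ∀ᶠ u in 𝓝 T, AnalyticAt ℂ f (toExterior a e u) ∧
      deriv f (toExterior a e u) ≠ 0 ∧ e * u + a ≠ 0 := by
    refine (hγ.continuousAt.eventually hf.eventually_analyticAt).and
      ((hγ.continuousAt.eventually (hf.deriv.continuousAt.eventually_ne h0)).and ?_)
    exact (hlin T).continuousAt.eventually_ne hT
  have h1 : deriv (f ∘ toExterior a e) =ᶠ[𝓝 T] fun u =>
      deriv f (toExterior a e u) * (e * (‖a‖ ^ 2 - 1) / (e * u + a) ^ 2) := by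
    filter_upwards [hev] with u hu using deriv_comp_toExterior hu.1 hu.2.2
  have h2 : logDeriv (deriv (f ∘ toExterior a e)) =ᶠ[𝓝 T] fun u =>
      logDeriv (deriv f) (toExterior a e u) * (e * (‖a‖ ^ 2 - 1) / (e * u + a) ^ 2)
        - 2 * e / (e * u + a) := by
    filter_upwards [h1.eventually_nhds, hev] with u hu1 ⟨hu2, hu3, hu4⟩
    have hk := toExterior_deriv_ne_zero he ha hu4
    have hd := ((hu2.deriv.differentiableAt.hasDerivAt.comp u (hasDerivAt_toExterior hu4)).mul
      ((hasDerivAt_const u (e * ((‖a‖ : ℂ) ^ 2 - 1))).div ((hlin u).pow 2)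
        (pow_ne_zero 2 hu4))).deriv
    have hd' := (EventuallyEq.deriv_eq hu1).trans hd
    have hk' : e * ((‖a‖ : ℂ) ^ 2 - 1) ≠ 0 := fun h => hk (by rw [h, zero_div])
    have he' := left_ne_zero_of_mul hk'
    have ha' := right_ne_zero_of_mul hk'
    rw [logDeriv_apply, hd', EventuallyEq.eq_of_nhds hu1, logDeriv_apply]
    simp only [Function.comp_apply, Pi.div_apply, Pi.pow_apply]
    field_simp
    push_cast
    ring
  have hL := (analyticAt_logDeriv hf.deriv h0).differentiableAt.hasDerivAt
  have hd := (((hL.comp T (hasDerivAt_toExterior hT)).mul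
      ((hasDerivAt_const T (e * ((‖a‖ : ℂ) ^ 2 - 1))).div ((hlin T).pow 2)
        (pow_ne_zero 2 hT))).sub ((hasDerivAt_const T (2 * e)).div (hlin T) hT)).deriv
  have hd' := h2.deriv_eq.trans hd
  rw [schwarzianFormula, hd', h2.eq_of_nhds, schwarzianFormula]
  simp only [Function.comp_apply, Pi.div_apply, Pi.pow_apply]
  field_simp
  push_cast
  ring

end

/-! ### Transfer of `f` to the disk, including the point over `∞` -/

lemma isOpen_exteriorDisk : IsOpen exteriorDisk := isOpen_lt continuous_const continuous_norm

/-- The hypothesis on `schwarzian` is used only at such points; all others are reached through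
punctured neighbourhoods. -/
lemma schwarzian_eq_formula {f : ℂ → ℂ} {z : ℂ} (hf : AnalyticAt ℂ f z) (h0 : deriv f z ≠ 0) :
    schwarzian f z = schwarzianFormula f z := by
  have h := (analyticAt_schwarzianFormula hf h0).meromorphicNFAt
  have h1 := toMeromorphicNFAt_eq_self.2 h
  exact congrFun h1 z

lemma sphereValue_of_analyticAt {f : ℂ → ℂ} {z : ℂ} (hf : AnalyticAt ℂ f z) :
    sphereValue f z = (f z : OnePoint ℂ) :=
  if_neg (not_lt.2 hf.meromorphicOrderAt_nonneg)

/-- A locally univalent meromorphic function is locally nonconstant. -/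
lemma eventually_deriv_ne_zero {f : ℂ → ℂ} (hf : MeromorphicOn f exteriorDisk)
    (hloc : LocallyUnivalentOn f exteriorDisk) {z : ℂ} (hz : z ∈ exteriorDisk) :
    ∀ᶠ w in 𝓝[≠] z, deriv f w ≠ 0 := by
  refine (hf z hz).deriv.eventually_eq_zero_or_eventually_ne_zero.resolve_left fun hev => ?_
  obtain ⟨V, hV, hinj⟩ := hloc z hz
  rw [isOpen_exteriorDisk.nhdsWithin_eq hz] at hV
  have h1 : ∀ᶠ w in 𝓝[≠] z, deriv f w = 0 ∧ AnalyticAt ℂ f w ∧ w ∈ V :=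
    hev.and ((hf z hz).eventually_analyticAt.and
      (Filter.Eventually.filter_mono nhdsWithin_le_nhds hV))
  -- Moving to a nearby `w ≠ z` turns the punctured neighbourhood into a full one, where `f` is
  -- constant.
  obtain ⟨w, hw, hwz⟩ := ((eventually_eventually_nhdsWithin.2 h1).and self_mem_nhdsWithin).exists
  rw [isOpen_compl_singleton.nhdsWithin_eq hwz] at hw
  obtain ⟨ε, hε, hball⟩ := Metric.eventually_nhds_iff_ball.1 hw
  have hd : DifferentiableOn ℂ f (Metric.ball w ε) :=
    fun u hu => (hball u hu).2.1.differentiableAt.differentiableWithinAt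
  have hw0 : w ∈ Metric.ball w ε := Metric.mem_ball_self hε
  have hw1 : w + (ε / 2 : ℝ) ∈ Metric.ball w ε := by
    simp only [Metric.mem_ball, dist_eq_norm, add_sub_cancel_left, Complex.norm_real,
      Real.norm_of_nonneg (by positivity : 0 ≤ ε / 2)]
    linarith
  have hconst : f w = f (w + (ε / 2 : ℝ)) :=
    Metric.isOpen_ball.is_const_of_deriv_eq_zero (convex_ball w ε).isPreconnected hd
      (fun u hu => (hball u hu).1) hw0 hw1
  have h2 := hinj (hball _ hw0).2.2 (hball _ hw1).2.2 (by
    rw [sphereValue_of_analyticAt (hball _ hw0).2.1, sphereValue_of_analyticAt (hball _ hw1).2.1,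
      hconst])
  have h3 : ((ε / 2 : ℝ) : ℂ) = 0 := by simpa using h2.symm
  have h4 : ε / 2 = 0 := by exact_mod_cast h3
  linarith

/-- Terms of a convergent series tend to `0`, so the radius of convergence is at least `‖z‖ > 0`. -/
lemma analyticAt_tsum_of_summable {c : ℕ → ℂ} {z : ℂ} (hz : z ≠ 0)
    (hs : Summable fun n => c n * z ^ n) : AnalyticAt ℂ (fun w => ∑' n, c n * w ^ n) 0 := by
  set p := FormalMultilinearSeries.ofScalars ℂ c
  have hr : (‖z‖₊ : ENNReal) ≤ p.radius := by
    refine p.le_radius_of_tendsto (l := 0) ?_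
    simpa [p, FormalMultilinearSeries.ofScalars_norm] using hs.tendsto_atTop_zero.norm
  have hpos : 0 < p.radius := lt_of_lt_of_le (by simpa using hz) hr
  have h := (p.hasFPowerSeriesOnBall hpos).analyticAt
  convert h using 2 with w
  simp [FormalMultilinearSeries.sum, p, mul_comm]

/-- Analytic continuation of the Laurent expansion at `∞` makes `f ∘ γ` meromorphic where the
Möbius map `γ` has its pole. -/
lemma meromorphicAt_comp_toExterior_pole {f : ℂ → ℂ} (hf : MemSigma f) {a e T : ℂ}
    (he : ‖e‖ = 1) (ha : ‖a‖ < 1) (hT : e * T + a = 0) :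
    MeromorphicAt (f ∘ toExterior a e) T := by
  obtain ⟨b, c, R, hexp⟩ := hf.expansion
  set R' := max R 1
  have hexp' : ∀ ζ : ℂ, R' < ‖ζ‖ → HasSum (fun n : ℕ => c n * ζ⁻¹ ^ n) (f ζ - b * ζ) := by
    intro ζ hζ
    convert hexp ζ ((le_max_left _ _).trans_lt hζ) ((le_max_right _ _).trans_lt hζ) using 2
    rw [inv_pow, div_eq_mul_inv]
  have hR' : 1 ≤ R' := le_max_right _ _
  have hΦ : AnalyticAt ℂ (fun w => ∑' n, c n * w ^ n) 0 := by
    have h1 : R' < ‖((R' + 1 : ℝ) : ℂ)‖ := by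
      rw [Complex.norm_real, Real.norm_of_nonneg (by linarith)]
      linarith
    refine analyticAt_tsum_of_summable (inv_ne_zero ?_) (hexp' _ h1).summable
    exact norm_pos_iff.1 (by linarith)
  -- `δ = 1 / γ` is analytic at the pole of `γ`, so the expansion can be read as a power series in
  -- `δ` plus `b / δ`.
  set δ : ℂ → ℂ := fun u => (e * u + a) / (1 + conj a * (e * u))
  have hden : 1 + conj a * (e * T) ≠ 0 := by
    have h := norm_sq_one_add_conj_mul_sub a (e * T)
    have h1 : e * T = -a := eq_neg_of_add_eq_zero_left hT
    rw [hT, h1, norm_neg, norm_zero] at h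
    intro h2
    rw [h1] at h2
    rw [h2, norm_zero] at h
    have h3 : 0 < 1 - ‖a‖ ^ 2 := by nlinarith [norm_nonneg a]
    nlinarith
  have hδ : AnalyticAt ℂ δ T := by
    simp only [δ]
    fun_prop (disch := exact hden)
  have hδ0 : δ T = 0 := by simp [δ, hT]
  have hinv : ∀ u, toExterior a e u = (δ u)⁻¹ := fun u => (inv_div _ _).symm
  have he0 : e ≠ 0 := norm_ne_zero_iff.1 (by rw [he]; exact one_ne_zero)
  have hne : ∀ᶠ u in 𝓝[≠] T, δ u ≠ 0 := by
    have hden' : ∀ᶠ u in 𝓝 T, 1 + conj a * (e * u) ≠ 0 := by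
      have : ContinuousAt (fun u => 1 + conj a * (e * u)) T := by fun_prop
      exact this.eventually_ne hden
    filter_upwards [hden'.filter_mono nhdsWithin_le_nhds, self_mem_nhdsWithin] with u hu huT
    refine div_ne_zero ?_ hu
    intro h
    have : e * (u - T) = 0 := by linear_combination h - hT
    exact (mul_ne_zero he0 (sub_ne_zero.2 huT)) this
  have hsmall : ∀ᶠ u in 𝓝[≠] T, ‖δ u‖ < R'⁻¹ := by
    refine Filter.Eventually.filter_mono nhdsWithin_le_nhds ?_
    refine hδ.continuousAt.norm.eventually_lt_const ?_
    simp only [hδ0, norm_zero]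
    positivity
  have hmer : MeromorphicAt (fun u => b * (δ u)⁻¹ + ∑' n, c n * δ u ^ n) T := by
    refine ((MeromorphicAt.const b T).mul hδ.meromorphicAt.inv).add ?_
    have h1 : AnalyticAt ℂ (fun w => ∑' n, c n * w ^ n) (δ T) := by rwa [hδ0]
    exact (h1.comp hδ).meromorphicAt
  refine hmer.congr ?_
  filter_upwards [hne, hsmall] with u hu hu'
  have h1 : R' < ‖toExterior a e u‖ := by
    rw [hinv, norm_inv]
    exact (lt_inv_comm₀ (norm_pos_iff.2 hu) (by linarith)).1 hu'
  have h2 := (hexp' _ h1).tsum_eq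
  rw [hinv, inv_inv] at h2
  simp only [Function.comp_apply, hinv, h2]
  ring

/-- The bound is transported without loss because `γ` is a hyperbolic isometry: `|γ'| / (|γ|² - 1) =
1 / (1 - |T|²)`. -/
lemma schwarzianFormula_comp_toExterior_bound {f : ℂ → ℂ} (hf : MemSigma f)
    (hloc : LocallyUnivalentOn f exteriorDisk)
    (hS : ∀ ζ ∈ exteriorDisk, ‖schwarzian f ζ‖ ≤ 2 / (‖ζ‖ ^ 2 - 1) ^ 2)
    {a e T : ℂ} (he : ‖e‖ = 1) (ha : ‖a‖ < 1) (hT1 : ‖T‖ < 1) (hT : e * T + a ≠ 0) :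
    ∀ᶠ w in 𝓝[≠] T, deriv (f ∘ toExterior a e) w ≠ 0 ∧
      ‖schwarzianFormula (f ∘ toExterior a e) w‖ ≤ 2 / (1 - ‖w‖ ^ 2) ^ 2 := by
  have hγT := toExterior_mem he ha hT1 hT
  have htend := (hasDerivAt_toExterior hT).tendsto_nhdsNE (toExterior_deriv_ne_zero he ha hT)
  have hden : ∀ᶠ u in 𝓝 T, e * u + a ≠ 0 ∧ ‖u‖ < 1 := by
    have h1 : ContinuousAt (fun u => e * u + a) T := by fun_prop
    exact (h1.eventually_ne hT).and (continuousAt_id.norm.eventually_lt_const hT1)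
  filter_upwards [htend.eventually (eventually_deriv_ne_zero hf.meromorphic.meromorphicOn hloc hγT),
    htend.eventually (hf.meromorphic.meromorphicOn _ hγT).eventually_analyticAt,
    hden.filter_mono nhdsWithin_le_nhds] with w h1 h2 ⟨h3, h4⟩
  have hk := toExterior_deriv_ne_zero he ha h3
  refine ⟨by rw [deriv_comp_toExterior h2 h3]; exact mul_ne_zero h1 hk, ?_⟩
  have hb := hS _ (toExterior_mem he ha h4 h3)
  rw [schwarzian_eq_formula h2 h1] at hb
  rw [schwarzianFormula_comp_toExterior he ha h2 h1 h3, norm_mul, norm_pow,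
    norm_toExterior_deriv he ha]
  refine (mul_le_mul_of_nonneg_right hb (by positivity)).trans_eq ?_
  rw [norm_toExterior_sq_sub_one he h3]
  have h5 : ‖e * w + a‖ ≠ 0 := norm_ne_zero_iff.2 h3
  have h6 : 1 - ‖w‖ ^ 2 ≠ 0 := by nlinarith [norm_nonneg w]
  have h7 : 1 - ‖a‖ ^ 2 ≠ 0 := by nlinarith [norm_nonneg a]
  field_simp

/-- A Schwarzian bound valid off a point extends to that point. -/
lemma schwarzianFormula_bound_of_punctured {g : ℂ → ℂ} {T : ℂ} (hT : T ∈ Metric.ball (0 : ℂ) 1)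
    (hg : MeromorphicAt g T)
    (h : ∀ᶠ z in 𝓝[≠] T, ∀ᶠ w in 𝓝[≠] z,
      deriv g w ≠ 0 ∧ ‖schwarzianFormula g w‖ ≤ 2 / (1 - ‖w‖ ^ 2) ^ 2) :
    ∀ᶠ w in 𝓝[≠] T, deriv g w ≠ 0 ∧ ‖schwarzianFormula g w‖ ≤ 2 / (1 - ‖w‖ ^ 2) ^ 2 := by
  have hne : ∀ᶠ w in 𝓝[≠] T, deriv g w ≠ 0 := by
    refine hg.deriv.eventually_eq_zero_or_eventually_ne_zero.resolve_left fun hev => ?_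
    obtain ⟨z, ⟨hz, hz'⟩, hzT⟩ :=
      (((eventually_eventually_nhdsWithin.2 hev).and h).and self_mem_nhdsWithin).exists
    rw [isOpen_compl_singleton.nhdsWithin_eq hzT] at hz
    obtain ⟨w, hw, hw'⟩ := ((hz.filter_mono nhdsWithin_le_nhds).and hz').exists
    exact hw'.1 hw
  filter_upwards [hne, h, hg.eventually_analyticAt,
    mem_nhdsWithin_of_mem_nhds (Metric.isOpen_ball.mem_nhds hT)] with z hz hz' hgz hzb
  refine ⟨hz, ?_⟩
  exact le_of_tendsto_of_tendsto
    ((analyticAt_schwarzianFormula hgz hz).continuousAt.norm.tendsto.mono_left nhdsWithin_le_nhds)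
    ((continuousAt_nehari_bound hzb).tendsto.mono_left nhdsWithin_le_nhds)
    (hz'.mono fun w hw => hw.2)

/-! ### Geodesics and the conclusion -/

/-- Any two points of the exterior disk are joined by a hyperbolic geodesic `toExterior a e`. -/
lemma exists_toExterior {ζ₁ ζ₂ : ℂ} (h₁ : ζ₁ ∈ exteriorDisk) (h₂ : ζ₂ ∈ exteriorDisk)
    (hne : ζ₁ ≠ ζ₂) : ∃ (a e : ℂ) (r : ℝ), ‖a‖ < 1 ∧ ‖e‖ = 1 ∧ 0 < r ∧ r < 1 ∧
      e * 0 + a ≠ 0 ∧ e * r + a ≠ 0 ∧ toExterior a e 0 = ζ₁ ∧ toExterior a e r = ζ₂ := by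
  have hz₁ : ζ₁ ≠ 0 := norm_pos_iff.1 (one_pos.trans h₁)
  have hz₂ : ζ₂ ≠ 0 := norm_pos_iff.1 (one_pos.trans h₂)
  obtain ⟨a, rfl⟩ : ∃ a, a⁻¹ = ζ₁ := ⟨ζ₁⁻¹, inv_inv _⟩
  obtain ⟨b, rfl⟩ : ∃ b, b⁻¹ = ζ₂ := ⟨ζ₂⁻¹, inv_inv _⟩
  have ha0 : a ≠ 0 := by simpa using hz₁
  have hb0 : b ≠ 0 := by simpa using hz₂
  have hab : b - a ≠ 0 := sub_ne_zero.2 fun h => hne (by rw [h])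
  have ha : ‖a‖ < 1 := by
    have : 1 < ‖a‖⁻¹ := by rw [← norm_inv]; exact h₁
    exact (one_lt_inv₀ (norm_pos_iff.2 ha0)).1 this
  have hb : ‖b‖ < 1 := by
    have : 1 < ‖b‖⁻¹ := by rw [← norm_inv]; exact h₂
    exact (one_lt_inv₀ (norm_pos_iff.2 hb0)).1 this
  have ha2 : 0 < 1 - ‖a‖ ^ 2 := by nlinarith [norm_nonneg a]
  have hb2 : 0 < 1 - ‖b‖ ^ 2 := by nlinarith [norm_nonneg b]
  have hid := norm_sq_one_add_conj_mul_sub (-a) b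
  rw [norm_neg, map_neg, neg_mul, ← sub_eq_add_neg, ← sub_eq_add_neg] at hid
  have hlt : ‖b - a‖ < ‖1 - conj a * b‖ := by
    have : 0 < (1 - ‖b‖ ^ 2) * (1 - ‖a‖ ^ 2) := mul_pos hb2 ha2
    exact lt_of_pow_lt_pow_left₀ 2 (norm_nonneg _) (by linarith)
  have hden : 1 - conj a * b ≠ 0 := norm_pos_iff.1 ((norm_nonneg _).trans_lt hlt)
  -- The disk automorphism taking `a` to `0` sends `b` to `w`; then `r = ‖w‖`, and `e = w / ‖w‖`
  -- rotates `r` to `w`.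
  set w := (b - a) / (1 - conj a * b)
  have hw0 : w ≠ 0 := div_ne_zero hab hden
  have hw1 : ‖w‖ < 1 := by
    rw [norm_div, div_lt_one (norm_pos_iff.2 hden)]
    exact hlt
  have hwn : (‖w‖ : ℂ) ≠ 0 := by exact_mod_cast norm_ne_zero_iff.2 hw0
  have hew : w / ‖w‖ * (‖w‖ : ℂ) = w := div_mul_cancel₀ _ hwn
  have haa : (1 : ℂ) - conj a * a ≠ 0 := by
    rw [mul_comm, Complex.mul_conj, Complex.normSq_eq_norm_sq]
    exact_mod_cast ha2.ne'
  have hwa : w + a = b * (1 - conj a * a) / (1 - conj a * b) := by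
    rw [div_add' _ _ _ hden]
    congr 1; ring
  have hwc : 1 + conj a * w = (1 - conj a * a) / (1 - conj a * b) := by
    rw [← mul_div_assoc, add_div' _ _ _ hden]
    congr 1; ring
  refine ⟨a, w / ‖w‖, ‖w‖, ha, ?_, norm_pos_iff.2 hw0, hw1, by simpa using ha0, ?_, ?_, ?_⟩
  · rw [norm_div, Complex.norm_real, norm_norm, div_self (norm_ne_zero_iff.2 hw0)]
  · rw [hew, hwa]
    exact div_ne_zero (mul_ne_zero hb0 haa) hden
  · simp [toExterior]
  · rw [toExterior, hew, hwa, hwc]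
    field_simp

/-- Equality of values on the sphere in terms of orders. -/
lemma order_of_sphereValue_eq {f : ℂ → ℂ} {z w : ℂ} (hz : MeromorphicNFAt f z)
    (hw : MeromorphicNFAt f w) (h : sphereValue f z = sphereValue f w) :
    (meromorphicOrderAt f z < 0 ∧ meromorphicOrderAt f w < 0) ∨
      ∃ c, 0 < meromorphicOrderAt (fun u => f u - c) z ∧
        0 < meromorphicOrderAt (fun u => f u - c) w := by
  have key : ∀ {u c : ℂ}, MeromorphicNFAt f u → ¬ meromorphicOrderAt f u < 0 → f u = c →
      0 < meromorphicOrderAt (fun u => f u - c) u := by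
    intro u c hu h0 hc
    have hA := hu.meromorphicOrderAt_nonneg_iff_analyticAt.1 (not_lt.1 h0)
    have hA' : AnalyticAt ℂ (fun u => f u - c) u := hA.sub analyticAt_const
    refine lt_of_le_of_ne hA'.meromorphicOrderAt_nonneg fun h => ?_
    exact hA'.meromorphicNFAt.meromorphicOrderAt_eq_zero_iff.1 h.symm (sub_eq_zero.2 hc)
  unfold sphereValue at h
  split_ifs at h with h1 h2 h2
  · exact Or.inl ⟨h1, h2⟩
  · exact absurd h (OnePoint.infty_ne_coe _)
  · exact absurd h (OnePoint.coe_ne_infty _)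
  · exact Or.inr ⟨f z, key hz h1 rfl, key hw h2 (OnePoint.coe_eq_coe.1 h).symm⟩

theorem corollaryc5 (f : ℂ → ℂ) (hf : MemSigma f)
    (hloc : LocallyUnivalentOn f exteriorDisk)
    (hS : ∀ ζ ∈ exteriorDisk, ‖schwarzian f ζ‖ ≤ 2 / (‖ζ‖ ^ 2 - 1) ^ 2) :
    UnivalentOn f exteriorDisk := by
  intro ζ₁ h₁ ζ₂ h₂ heq
  by_contra hne
  obtain ⟨a, e, r, ha, he, hr0, hr1, hd0, hdr, hγ0, hγr⟩ := exists_toExterior h₁ h₂ hne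
  have he0 : e ≠ 0 := norm_ne_zero_iff.1 (by rw [he]; exact one_ne_zero)
  have hmer : MeromorphicOn (f ∘ toExterior a e) (Metric.ball 0 1) := by
    intro T hT
    by_cases hd : e * T + a = 0
    · exact meromorphicAt_comp_toExterior_pole hf he ha hd
    · exact (hf.meromorphic.meromorphicOn _
        (toExterior_mem he ha (by simpa using hT) hd)).comp_analyticAt (analyticAt_toExterior hd)
  have hord : ∀ (g : ℂ → ℂ) (T : ℂ), e * T + a ≠ 0 →
      meromorphicOrderAt (g ∘ toExterior a e) T = meromorphicOrderAt g (toExterior a e T) := by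
    intro g T hT
    refine meromorphicOrderAt_comp_of_deriv_ne_zero (analyticAt_toExterior hT) ?_
    rw [(hasDerivAt_toExterior hT).deriv]
    exact toExterior_deriv_ne_zero he ha hT
  refine nehari_zero_real hr0 hr1 hmer ?_ ?_
  · intro T hT
    by_cases hd : e * T + a = 0
    -- At the pole of `γ` there is no finite point of the exterior to evaluate at; the bound comes
    -- from the points around it.
    · refine schwarzianFormula_bound_of_punctured hT (hmer T hT) ?_
      filter_upwards [self_mem_nhdsWithin,
        mem_nhdsWithin_of_mem_nhds (Metric.isOpen_ball.mem_nhds hT)] with u hu hub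
      refine schwarzianFormula_comp_toExterior_bound hf hloc hS he ha (by simpa using hub) ?_
      intro h
      exact mul_ne_zero he0 (sub_ne_zero.2 hu) (by linear_combination h - hd)
    · exact schwarzianFormula_comp_toExterior_bound hf hloc hS he ha (by simpa using hT) hd
  · rcases order_of_sphereValue_eq (hf.meromorphic h₁) (hf.meromorphic h₂) heq with
      ⟨hn1, hn2⟩ | ⟨c, hc1, hc2⟩
    · left
      rw [hord f 0 hd0, hord f r hdr, hγ0, hγr]
      exact ⟨hn1, hn2⟩
    · right
      refine ⟨c, ?_, ?_⟩
      · have := hord (fun u => f u - c) 0 hd0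
        rw [hγ0] at this
        exact hc1.trans_eq this.symm
      · have := hord (fun u => f u - c) r hdr
        rw [hγr] at this
        exact hc2.trans_eq this.symm
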